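/- Let $d\ge 1$ and fix a norm $\|\cdot\|$ on $\mathbf R^d$ (the reference norm) such that the positive orthant of its unit sphere, $\mathbf S_+^{d-1}=\{x\in\mathbf R_+^d:\|x\|=1\}$, is contained in $[0,1]^d$. Powers of vectors and suprema of vectors are taken coordinatewise. An angular measure is a finite measure $\nu$ on $\mathbf S_+^{d-1}$ with $\int u^j\,d\nu(u)=1$ for $j=1,\dots,d$. For $\alpha>0$ and an angular measure $\nu$, let $\mu$ be the image of $\alpha r^{-(\alpha+1)}dr\otimes d\nu(u)$ on $(0,\infty)\times\mathbf S_+^{d-1}$ under $(r,u)\mapsto r\,u^{1/\alpha}$; the max-stable law $\mathcal{MS}(\alpha,\nu)$ is the law of $\sup_{i\ge1}y_i$, where $(y_i)_{i\ge1}$ are the points of a Poisson process with intensity measure $\mu$. Let $\nu_\alpha$ be the image of $\nu$ under $u\mapsto u^{1/\alpha}$. Let $\mathrm{Lip}_1^{[2]}(\mathbf R_+^d)$ be the set of functions $h:\mathbf R_+^d\to\mathbf R$ that are $1$-Lipschitz and whose partial derivatives $\partial_1h,\dots,\partial_dh$ exist on $\mathbf R_+^d$ (one-sided at the boundary) and are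 $1$-Lipschitz, all with respect to $\|x\|_1=\sum_j|x^j|$, and put $$\mathrm d_{[2]}(X,Y)=\sup_{h\in\mathrm{Lip}_1^{[2]}(\mathbf R_+^d)}\big|\mathbf E[h(X)]-\mathbf E[h(Y)]\big|.$$ Then there is a function $\alpha\mapsto C_\alpha>0$ on $(1,\infty)$, depending only on $d$ and the fixed reference norm, such that the following holds for every $\alpha>1$ and every angular measure $\nu$. Let $((r_i,v_i))_{i\ge1}$, arranged so that $r_1\ge r_2\ge\cdots$, be the points of a Poisson process with intensity measure $\alpha r^{-(\alpha+1)}dr\otimes d\nu_\alpha(v)$, let $Z_n=\sup_{1\le i\le n}r_iv_i$, and let $Z\sim\mathcal{MS}(\alpha,\nu)$. Then, for all $n\ge2$, $h(Z_n)$ and $h(Z)$ are integrable for every $h\in\mathrm{Lip}_1^{[2]}(\mathbf R_+^d)$ and $$\mathrm d_{[2]}(Z_n,Z)\le \frac{C_\alpha}{n^{1+1/\alpha}}.$$ Moreover $C_\alpha=O\big((1-\tfrac1\alpha)^{-2}\big)$ as $\alpha\to1^+$. -/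

import Mathlib

open MeasureTheory ProbabilityTheory Filter Topology Asymptotics
open scoped ENNReal NNReal

noncomputable section

namespace MaxStable

/-- A random measure `η` on `S`, defined on the probability space `(Ω, P)`, is a Poisson process
with intensity measure `Λ`: `η B` has the Poisson law with parameter `Λ B` (with the convention
that the Poisson law with parameter `∞` is the Dirac mass at `∞`), and the values of `η` on
finitely many pairwise disjoint measurable sets are independent. -/
structure IsPoissonProcess {Ω S : Type*} [MeasurableSpace Ω] [MeasurableSpace S]
    (P : Measure Ω) (η : Ω → Measure S) (Λ : Measure S) : Prop where
  measurable : Measurable η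
  law_of_ne_top : ∀ B : Set S, MeasurableSet B → Λ B ≠ ∞ →
    P.map (fun ω => η ω B) = (poissonMeasure (Λ B).toNNReal).map (fun k : ℕ => (k : ℝ≥0∞))
  eq_top : ∀ B : Set S, MeasurableSet B → Λ B = ∞ → ∀ᵐ ω ∂P, η ω B = ∞
  indep : ∀ (m : ℕ) (B : Fin m → Set S), (∀ k, MeasurableSet (B k)) →
    Pairwise (fun k l => Disjoint (B k) (B l)) → iIndepFun (fun k ω => η ω (B k)) P

/-- The random counting measure `∑ i, δ_{x i}` of a random sequence of points. -/
def countingMeasure {Ω S : Type*} [MeasurableSpace S] (x : ℕ → Ω → S) (ω : Ω) : Measure S :=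
  Measure.sum fun i => Measure.dirac (x i ω)

/-- The positive orthant of the unit sphere of the norm `N` on `ℝ^d`. -/
def posSphere {d : ℕ} (N : Seminorm ℝ (Fin d → ℝ)) : Set (Fin d → ℝ) :=
  {x | 0 ≤ x ∧ N x = 1}

/-- `ν` is an angular measure: a finite measure on the positive orthant of the unit sphere
with `∫ u^j dν(u) = 1` for every coordinate `j`. -/
structure IsAngularMeasure {d : ℕ} (N : Seminorm ℝ (Fin d → ℝ)) (ν : Measure (Fin d → ℝ)) :
    Prop where
  finite : IsFiniteMeasure ν
  support : ν (posSphere N)ᶜ = 0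
  moment : ∀ j, ∫ u, u j ∂ν = 1

/-- The measure `α r^{-(α+1)} dr` on `(0, ∞)`. -/
def radialMeasure (α : ℝ) : Measure ℝ :=
  (volume.restrict (Set.Ioi 0)).withDensity fun r => ENNReal.ofReal (α * r ^ (-(α + 1)))

/-- The coordinatewise power `u^{1/α}`. -/
def rootVec {d : ℕ} (α : ℝ) (u : Fin d → ℝ) : Fin d → ℝ := fun j => u j ^ (1 / α)

/-- The measure `ν_α`, image of `ν` under `u ↦ u^{1/α}`. -/
def angularRoot {d : ℕ} (α : ℝ) (ν : Measure (Fin d → ℝ)) : Measure (Fin d → ℝ) :=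
  ν.map (rootVec α)

/-- The intensity `α r^{-(α+1)} dr ⊗ dν_α(v)` of the Poisson process in polar coordinates. -/
def polarIntensity {d : ℕ} (α : ℝ) (ν : Measure (Fin d → ℝ)) : Measure (ℝ × (Fin d → ℝ)) :=
  (radialMeasure α).prod (angularRoot α ν)

/-- The exponent measure `μ` with stability index `α` and angular measure `ν`: the image of
`α r^{-(α+1)} dr ⊗ dν(u)` under `(r, u) ↦ r u^{1/α}`. -/
def exponentMeasure {d : ℕ} (α : ℝ) (ν : Measure (Fin d → ℝ)) : Measure (Fin d → ℝ) :=
  ((radialMeasure α).prod ν).map fun p => p.1 • rootVec α p.2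

/-- `Q` is the max-stable law `MS(α, ν)`: the law of the coordinatewise supremum of the points
of a Poisson process whose intensity is the exponent measure of `(α, ν)`. -/
def IsMaxStableLaw {d : ℕ} (α : ℝ) (ν Q : Measure (Fin d → ℝ)) : Prop :=
  ∃ (Ω : Type) (_ : MeasurableSpace Ω) (P : Measure Ω) (y : ℕ → Ω → Fin d → ℝ)
    (Y : Ω → Fin d → ℝ),
    IsProbabilityMeasure P ∧ (∀ i, Measurable (y i)) ∧ Measurable Y ∧
    IsPoissonProcess P (countingMeasure y) (exponentMeasure α ν) ∧
    (∀ᵐ ω ∂P, IsLUB (Set.range fun i => y i ω) (Y ω)) ∧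
    P.map Y = Q

/-- `((r i, v i))_{i ≥ 0}` are the points, listed by decreasing first coordinate, of a Poisson
process with intensity `α r^{-(α+1)} dr ⊗ dν_α(v)`. -/
structure IsLePageSequence {Ω : Type*} [MeasurableSpace Ω] {d : ℕ} (P : Measure Ω) (α : ℝ)
    (ν : Measure (Fin d → ℝ)) (r : ℕ → Ω → ℝ) (v : ℕ → Ω → Fin d → ℝ) : Prop where
  measurable_r : ∀ i, Measurable (r i)
  measurable_v : ∀ i, Measurable (v i)
  poisson : IsPoissonProcess P (countingMeasure fun i ω => (r i ω, v i ω)) (polarIntensity α ν)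
  antitone : ∀ᵐ ω ∂P, Antitone fun i => r i ω

/-- The partial de Haan-LePage series: the coordinatewise maximum of the first `n` (where `n ≥ 1`)
of the vectors `r i • v i`. -/
def partialMax {Ω : Type*} {d : ℕ} (r : ℕ → Ω → ℝ) (v : ℕ → Ω → Fin d → ℝ) (n : ℕ) (ω : Ω) :
    Fin d → ℝ :=
  fun j => ⨆ i : Fin n, r i ω * v i ω j

/-- `f` is `1`-Lipschitz on the orthant `ℝ_+^d` for the norm `‖x‖₁ = ∑ j, |x j|`. -/
def IsLipOne {d : ℕ} (f : (Fin d → ℝ) → ℝ) : Prop :=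
  ∀ x y : Fin d → ℝ, 0 ≤ x → 0 ≤ y → |f x - f y| ≤ ∑ j, |x j - y j|

/-- The `j`-th partial derivative on the orthant `ℝ_+^d` (one-sided where `x j = 0`). -/
def partialDeriv {d : ℕ} (h : (Fin d → ℝ) → ℝ) (j : Fin d) (x : Fin d → ℝ) : ℝ :=
  derivWithin (fun t => h (Function.update x j t)) (Set.Ici 0) (x j)

/-- The class of functions on `ℝ_+^d` that are `1`-Lipschitz and whose partial derivatives exist
and are `1`-Lipschitz. Only the restriction of `h` to the orthant matters. -/
structure IsLipTwo {d : ℕ} (h : (Fin d → ℝ) → ℝ) : Prop where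
  lip : IsLipOne h
  diff : ∀ (j : Fin d) (x : Fin d → ℝ), 0 ≤ x →
    DifferentiableWithinAt ℝ (fun t => h (Function.update x j t)) (Set.Ici 0) (x j)
  lip_partialDeriv : ∀ j : Fin d, IsLipOne (partialDeriv h j)

/-- The distance `d_[2]` between two laws on `ℝ_+^d`. -/
def dTwo {d : ℕ} (Q₁ Q₂ : Measure (Fin d → ℝ)) : ℝ≥0∞ :=
  ⨆ (h : (Fin d → ℝ) → ℝ) (_ : IsLipTwo h), ENNReal.ofReal |∫ x, h x ∂Q₁ - ∫ x, h x ∂Q₂|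

end MaxStable

end

namespace MaxStable

section Poisson

open scoped Nat

lemma poissonMeasure_Ici_le (c : ℝ≥0) (n : ℕ) :
    poissonMeasure c (Set.Ici n) ≤ ENNReal.ofReal ((c : ℝ) ^ n / n !) := by
  have hcover : Set.Ici n = ⋃ k : ℕ, {n + k} := by
    ext m
    simp only [Set.mem_Ici, Set.mem_iUnion, Set.mem_singleton_iff]
    exact le_iff_exists_add
  have hterm (k : ℕ) : poissonMeasure c {n + k} ≤
      ENNReal.ofReal ((c : ℝ) ^ n / n !) * poissonMeasure c {k} := by
    rw [poissonMeasure_singleton, poissonMeasure_singleton, ← ENNReal.ofReal_mul (by positivity)]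
    apply ENNReal.ofReal_le_ofReal
    have hfac : ((n ! : ℝ) * k !) ≤ ((n + k) ! : ℕ) := by
      exact_mod_cast Nat.le_of_dvd (Nat.factorial_pos _)
        (Nat.factorial_mul_factorial_dvd_factorial_add n k)
    calc Real.exp (-c) * (c : ℝ) ^ (n + k) / ((n + k) ! : ℕ)
        ≤ Real.exp (-c) * (c : ℝ) ^ (n + k) / ((n ! : ℝ) * k !) := by gcongr
      _ = (c : ℝ) ^ n / n ! * (Real.exp (-c) * (c : ℝ) ^ k / k !) := by
          rw [pow_add]; field_simp
  calc poissonMeasure c (Set.Ici n) ≤ ∑' k, poissonMeasure c {n + k} := by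
        rw [hcover]; exact measure_iUnion_le _
    _ ≤ ∑' k, ENNReal.ofReal ((c : ℝ) ^ n / n !) * poissonMeasure c {k} :=
        ENNReal.tsum_le_tsum hterm
    _ = ENNReal.ofReal ((c : ℝ) ^ n / n !) := by
        rw [ENNReal.tsum_mul_left, ← measure_iUnion (fun i j hij => by simpa using hij)
          (fun i => measurableSet_singleton i)]
        simp [Set.iUnion_of_singleton]

namespace IsPoissonProcess

variable {Ω S : Type*} [MeasurableSpace Ω] [MeasurableSpace S] {P : Measure Ω}
  {η : Ω → Measure S} {Λ : Measure S} {B : Set S}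

lemma measurable_apply (h : IsPoissonProcess P η Λ) (hB : MeasurableSet B) :
    Measurable fun ω => η ω B :=
  (Measure.measurable_coe hB).comp h.measurable

lemma measure_ge_le (h : IsPoissonProcess P η Λ) (hB : MeasurableSet B) (hfin : Λ B ≠ ∞)
    (n : ℕ) :
    P {ω | (n : ℝ≥0∞) ≤ η ω B} ≤ ENNReal.ofReal ((Λ B).toReal ^ n / n !) := by
  have hmap := Measure.map_apply (μ := P) (h.measurable_apply hB)
    (measurableSet_Ici (a := (n : ℝ≥0∞)))
  rw [h.law_of_ne_top B hB hfin, Measure.map_apply .of_discrete measurableSet_Ici] at hmap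
  have hpre : (fun k : ℕ => (k : ℝ≥0∞)) ⁻¹' Set.Ici (n : ℝ≥0∞) = Set.Ici n := by
    ext k; simp
  rw [hpre] at hmap
  exact hmap.symm.trans_le (poissonMeasure_Ici_le _ n)

lemma measure_eq_zero (h : IsPoissonProcess P η Λ) (hB : MeasurableSet B) (hfin : Λ B ≠ ∞) :
    P {ω | η ω B = 0} = ENNReal.ofReal (Real.exp (-(Λ B).toReal)) := by
  have hmap := Measure.map_apply (μ := P) (h.measurable_apply hB)
    (measurableSet_singleton (0 : ℝ≥0∞))
  rw [h.law_of_ne_top B hB hfin,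
    Measure.map_apply .of_discrete (measurableSet_singleton _)] at hmap
  have hpre : (fun k : ℕ => (k : ℝ≥0∞)) ⁻¹' {0} = {0} := by
    ext k; simp
  rw [hpre, poissonMeasure_singleton] at hmap
  refine hmap.symm.trans ?_
  simp [ENNReal.coe_toNNReal_eq_toReal]

lemma measure_eq_zero_of_top [IsProbabilityMeasure P] (h : IsPoissonProcess P η Λ)
    (hB : MeasurableSet B) (htop : Λ B = ∞) : P {ω | η ω B = 0} = 0 := by
  rw [← compl_mem_ae_iff]
  filter_upwards [h.eq_top B hB htop] with ω hω
  simp [hω]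

lemma ae_eq_zero [IsProbabilityMeasure P] (h : IsPoissonProcess P η Λ) (hB : MeasurableSet B)
    (hzero : Λ B = 0) : ∀ᵐ ω ∂P, η ω B = 0 := by
  refine (mem_ae_iff_prob_eq_one (h.measurable_apply hB (measurableSet_singleton 0))).2 ?_
  have := h.measure_eq_zero hB (by simp [hzero])
  simpa [hzero, Set.preimage] using this

end IsPoissonProcess

section countingMeasure

variable {Ω S : Type*} [MeasurableSpace S] {x : ℕ → Ω → S} {ω : Ω} {B : Set S}

lemma countingMeasure_eq_zero_iff (hB : MeasurableSet B) :
    countingMeasure x ω B = 0 ↔ ∀ i, x i ω ∉ B := by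
  simp [countingMeasure, Measure.sum_apply _ hB, Measure.dirac_apply' _ hB]

lemma le_countingMeasure (hB : MeasurableSet B) {n : ℕ} (h : ∀ i < n, x i ω ∈ B) :
    (n : ℝ≥0∞) ≤ countingMeasure x ω B := by
  rw [countingMeasure, Measure.sum_apply _ hB]
  calc (n : ℝ≥0∞) = ∑ i ∈ Finset.range n, Measure.dirac (x i ω) B := by
        rw [Finset.sum_congr rfl fun i hi => Measure.dirac_apply_of_mem
          (h i (Finset.mem_range.1 hi))]
        simp
    _ ≤ _ := ENNReal.sum_le_tsum _

lemma countingMeasure_comp {T : Type*} [MeasurableSpace T] {f : S → T} (hf : Measurable f) :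
    countingMeasure (fun i ω => f (x i ω)) = fun ω => (countingMeasure x ω).map f := by
  ext ω : 1
  simp only [countingMeasure]
  rw [Measure.map_sum hf.aemeasurable]
  simp [Measure.map_dirac' hf]

end countingMeasure

lemma IsPoissonProcess.map {Ω S T : Type*} [MeasurableSpace Ω] [MeasurableSpace S]
    [MeasurableSpace T] {P : Measure Ω} {η : Ω → Measure S} {Λ : Measure S}
    (h : IsPoissonProcess P η Λ) {f : S → T} (hf : Measurable f) :
    IsPoissonProcess P (fun ω => (η ω).map f) (Λ.map f) where
  measurable := (Measure.measurable_map f hf).comp h.measurable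
  law_of_ne_top B hB hfin := by
    simp only [Measure.map_apply hf hB] at hfin ⊢
    exact h.law_of_ne_top _ (hf hB) hfin
  eq_top B hB htop := by
    simp only [Measure.map_apply hf hB] at htop ⊢
    exact h.eq_top _ (hf hB) htop
  indep m B hB hdisj := by
    simp only [Measure.map_apply hf (hB _)]
    exact h.indep m _ (fun k => hf (hB k)) fun k l hkl => (hdisj hkl).preimage f

end Poisson

section SupLaw

lemma ext_of_Iic_pi {d : ℕ} {Q₁ Q₂ : Measure (Fin d → ℝ)} [IsProbabilityMeasure Q₁]
    [IsProbabilityMeasure Q₂] (h : ∀ x, Q₁ (Set.Iic x) = Q₂ (Set.Iic x)) : Q₁ = Q₂ := by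
  have hspan : IsCountablySpanning (Set.range (Set.Iic : ℝ → Set ℝ)) := by
    refine ⟨fun n : ℕ => Set.Iic (n : ℝ), fun n => ⟨n, rfl⟩, ?_⟩
    exact Set.iUnion_eq_univ_iff.2 fun x => exists_nat_ge x
  have hgen : MeasurableSpace.generateFrom (Set.range (Set.Iic : ℝ → Set ℝ)) =
      (inferInstance : MeasurableSpace ℝ) := by
    rw [BorelSpace.measurable_eq (α := ℝ), borel_eq_generateFrom_Iic]
  refine ext_of_generate_finite _ (generateFrom_eq_pi (fun _ : Fin d => hgen)
    fun _ => hspan).symm (IsPiSystem.pi fun _ => isPiSystem_Iic) ?_ (by simp)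
  rintro _ ⟨s, hs, rfl⟩
  choose x hx using fun i => hs i (Set.mem_univ i)
  have : Set.univ.pi s = Set.Iic x := by
    rw [← Set.pi_univ_Iic]
    exact congrArg _ (funext fun i => (hx i).symm)
  rw [this, h]

lemma map_Iic_of_isLUB {d : ℕ} {Ω : Type*} [MeasurableSpace Ω] {P : Measure Ω}
    {y : ℕ → Ω → Fin d → ℝ} {Y : Ω → Fin d → ℝ} (hY : Measurable Y)
    (hlub : ∀ᵐ ω ∂P, IsLUB (Set.range fun i => y i ω) (Y ω)) (x : Fin d → ℝ) :
    P.map Y (Set.Iic x) = P {ω | countingMeasure y ω (Set.Iic x)ᶜ = 0} := by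
  rw [Measure.map_apply hY measurableSet_Iic]
  apply measure_congr
  filter_upwards [hlub] with ω hω
  apply propext
  change Y ω ≤ x ↔ countingMeasure y ω (Set.Iic x)ᶜ = 0
  rw [countingMeasure_eq_zero_iff measurableSet_Iic.compl, isLUB_le_iff hω]
  simp [mem_upperBounds]

/-- The law of the supremum of the points of a Poisson process is determined by the intensity. -/
lemma map_eq_of_isLUB {d : ℕ} {Ω Ω' : Type*} [MeasurableSpace Ω] [MeasurableSpace Ω']
    {P : Measure Ω} {P' : Measure Ω'} [IsProbabilityMeasure P] [IsProbabilityMeasure P']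
    {Λ : Measure (Fin d → ℝ)} {y : ℕ → Ω → Fin d → ℝ} {y' : ℕ → Ω' → Fin d → ℝ}
    {Y : Ω → Fin d → ℝ} {Y' : Ω' → Fin d → ℝ} (hY : Measurable Y) (hY' : Measurable Y')
    (h : IsPoissonProcess P (countingMeasure y) Λ)
    (h' : IsPoissonProcess P' (countingMeasure y') Λ)
    (hlub : ∀ᵐ ω ∂P, IsLUB (Set.range fun i => y i ω) (Y ω))
    (hlub' : ∀ᵐ ω ∂P', IsLUB (Set.range fun i => y' i ω) (Y' ω)) :
    P.map Y = P'.map Y' := by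
  have := Measure.isProbabilityMeasure_map (μ := P) hY.aemeasurable
  have := Measure.isProbabilityMeasure_map (μ := P') hY'.aemeasurable
  refine ext_of_Iic_pi fun x => ?_
  rw [map_Iic_of_isLUB hY hlub, map_Iic_of_isLUB hY' hlub']
  by_cases htop : Λ (Set.Iic x)ᶜ = ∞
  · rw [h.measure_eq_zero_of_top measurableSet_Iic.compl htop,
      h'.measure_eq_zero_of_top measurableSet_Iic.compl htop]
  · rw [h.measure_eq_zero measurableSet_Iic.compl htop,
      h'.measure_eq_zero measurableSet_Iic.compl htop]

end SupLaw

section Intensity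

variable {d : ℕ} {N : Seminorm ℝ (Fin d → ℝ)} {ν : Measure (Fin d → ℝ)} {α : ℝ}

instance : SFinite (radialMeasure α) := by unfold radialMeasure; infer_instance

instance [IsFiniteMeasure ν] : IsFiniteMeasure (angularRoot α ν) := by
  unfold angularRoot; infer_instance

lemma measurable_rootVec : Measurable (rootVec α : (Fin d → ℝ) → Fin d → ℝ) :=
  measurable_pi_lambda _ fun j => (measurable_pi_apply j).pow_const _

lemma radialMeasure_Ioi (hα : 0 < α) {s : ℝ} (hs : 0 < s) :
    radialMeasure α (Set.Ioi s) = ENNReal.ofReal (s ^ (-α)) := by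
  have hlt : -(α + 1) < -1 := by linarith
  rw [radialMeasure, withDensity_apply _ measurableSet_Ioi,
    Measure.restrict_restrict measurableSet_Ioi,
    Set.inter_eq_self_of_subset_left (Set.Ioi_subset_Ioi hs.le),
    ← ofReal_integral_eq_lintegral_ofReal]
  · rw [integral_const_mul, integral_Ioi_rpow_of_lt hlt hs]
    congr 1
    rw [show -(α + 1) + 1 = -α by ring]
    field_simp
  · exact (integrableOn_Ioi_rpow_of_lt hlt hs).const_mul α
  · filter_upwards [ae_restrict_mem measurableSet_Ioi] with t ht
    have : 0 < t := hs.trans ht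
    simp only [Pi.zero_apply]
    positivity

lemma radialMeasure_Iic_zero : radialMeasure α (Set.Iic 0) = 0 := by
  rw [radialMeasure, withDensity_apply _ measurableSet_Iic,
    Measure.restrict_restrict measurableSet_Iic, Set.Iic_inter_Ioi, Set.Ioc_self,
    Measure.restrict_empty, lintegral_zero_measure]

lemma polarIntensity_fst_gt [IsFiniteMeasure ν] (hα : 0 < α) {s : ℝ} (hs : 0 < s) :
    polarIntensity α ν {p | s < p.1} = ENNReal.ofReal (s ^ (-α)) * ν Set.univ := by
  have : {p : ℝ × (Fin d → ℝ) | s < p.1} = Set.Ioi s ×ˢ Set.univ := by ext; simp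
  rw [this, polarIntensity, Measure.prod_prod, radialMeasure_Ioi hα hs, angularRoot,
    Measure.map_apply measurable_rootVec .univ, Set.preimage_univ]

lemma measurableSet_fst_mul_gt (s : ℝ) (j : Fin d) :
    MeasurableSet {p : ℝ × (Fin d → ℝ) | s < p.1 * p.2 j} :=
  measurableSet_lt measurable_const
    (measurable_fst.mul ((measurable_pi_apply j).comp measurable_snd))

namespace IsAngularMeasure

lemma ae_mem_Icc (hν : IsAngularMeasure N ν) (hN : posSphere N ⊆ Set.Icc 0 1) :
    ∀ᵐ u ∂ν, u ∈ Set.Icc 0 1 := by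
  have h : ∀ᵐ u ∂ν, u ∈ posSphere N := hν.support
  exact h.mono fun u hu => hN hu

lemma integrable_apply (hν : IsAngularMeasure N ν) (j : Fin d) : Integrable (fun u => u j) ν := by
  by_contra h
  simpa [integral_undef h] using hν.moment j

lemma measureReal_univ_le (hν : IsAngularMeasure N ν) :
    ν.real Set.univ ≤ ∑ j, N (Pi.single j 1) := by
  have := hν.finite
  have h : ∀ᵐ u ∂ν, u ∈ posSphere N := hν.support
  calc ν.real Set.univ = ∫ _, (1 : ℝ) ∂ν := by simp
    _ ≤ ∫ u, ∑ j, u j * N (Pi.single j 1) ∂ν := by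
        refine integral_mono_ae (integrable_const _)
          (integrable_finsetSum _ fun j _ => (hν.integrable_apply j).mul_const _) ?_
        filter_upwards [h] with u hu
        calc (1 : ℝ) = N (∑ j, u j • Pi.single j 1) := by
              refine hu.2.symm.trans (congrArg N ?_)
              ext k
              simp [Finset.sum_apply, Pi.single_apply]
          _ ≤ ∑ j, N (u j • Pi.single j 1) :=
              Finset.le_sum_of_subadditive N (map_zero N).le (map_add_le_add N) _ _
          _ = ∑ j, u j * N (Pi.single j 1) := by
              refine Finset.sum_congr rfl fun j _ => ?_
              rw [map_smul_eq_mul, Real.norm_of_nonneg (hu.1 j)]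
    _ = ∑ j, N (Pi.single j 1) := by
        rw [integral_finsetSum _ fun j _ => (hν.integrable_apply j).mul_const _]
        simp [integral_mul_const, hν.moment]

lemma polarIntensity_mul_gt (hν : IsAngularMeasure N ν) (hα : 0 < α) {s : ℝ} (hs : 0 < s)
    (j : Fin d) :
    polarIntensity α ν {p | s < p.1 * p.2 j} = ENNReal.ofReal (s ^ (-α)) := by
  have := hν.finite
  have hmeas := measurableSet_fst_mul_gt s j
  have hpos : ∀ᵐ u ∂ν, u ∈ posSphere N := hν.support
  rw [polarIntensity, Measure.prod_apply_symm hmeas, angularRoot,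
    lintegral_map (measurable_measure_prodMk_right hmeas) measurable_rootVec]
  calc ∫⁻ u, radialMeasure α ((fun r => (r, rootVec α u)) ⁻¹' {p | s < p.1 * p.2 j}) ∂ν
      = ∫⁻ u, ENNReal.ofReal (s ^ (-α)) * ENNReal.ofReal (u j) ∂ν := by
        refine lintegral_congr_ae ?_
        filter_upwards [hpos] with u hu
        simp only [Set.preimage_ofPred_eq, rootVec]
        rcases (hu.1 j).eq_or_lt with h0 | h0
        · simp only [Pi.zero_apply] at h0
          simp [← h0, hα.ne', hs.not_gt]
        · simp only [Pi.zero_apply] at h0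
          have hroot : 0 < u j ^ (1 / α) := by positivity
          have : {r : ℝ | s < r * u j ^ (1 / α)} = Set.Ioi (s / u j ^ (1 / α)) := by
            ext r
            exact (div_lt_iff₀ hroot).symm
          rw [this, radialMeasure_Ioi hα (by positivity), ← ENNReal.ofReal_mul (by positivity)]
          congr 1
          rw [Real.div_rpow hs.le hroot.le, ← Real.rpow_mul h0.le,
            show 1 / α * -α = -1 by field_simp, Real.rpow_neg_one, div_inv_eq_mul]
    _ = ENNReal.ofReal (s ^ (-α)) := by
        rw [lintegral_const_mul _ (by fun_prop), ← ofReal_integral_eq_lintegral_ofReal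
          (hν.integrable_apply j) (hpos.mono fun u hu => hu.1 j), hν.moment j]
        simp

end IsAngularMeasure

lemma map_smul_polarIntensity [IsFiniteMeasure ν] :
    (polarIntensity α ν).map (fun p => p.1 • p.2) = exponentMeasure α ν := by
  rw [polarIntensity, angularRoot]
  conv_lhs => rw [← Measure.map_id (μ := radialMeasure α)]
  rw [Measure.map_prod_map _ _ measurable_id measurable_rootVec, exponentMeasure,
    Measure.map_map (by fun_prop) (measurable_id.prodMap measurable_rootVec)]
  rfl

end Intensity

section Dyadic

variable {Ω : Type*} [MeasurableSpace Ω] {P : Measure Ω}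

/-- A dyadic decomposition bounding the upper tail of the expectation. -/
lemma lintegral_indicator_gt_le {X : Ω → ℝ} (hX : Measurable X) {a b q : ℝ} (ha : 0 < a)
    (hb : 0 ≤ b) (hq : 0 ≤ q) (hq2 : 2 * q < 1)
    (htail : ∀ k : ℕ, P {ω | a * 2 ^ k < X ω} ≤ ENNReal.ofReal (b * q ^ k)) :
    ∫⁻ ω, {ω | a < X ω}.indicator (fun ω => ENNReal.ofReal (X ω)) ω ∂P ≤
      ENNReal.ofReal (2 * a * b / (1 - 2 * q)) := by
  have hset (k : ℕ) : MeasurableSet {ω | a * 2 ^ k < X ω} := measurableSet_lt measurable_const hX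
  calc ∫⁻ ω, {ω | a < X ω}.indicator (fun ω => ENNReal.ofReal (X ω)) ω ∂P
      ≤ ∫⁻ ω, ∑' k : ℕ, {ω | a * 2 ^ k < X ω}.indicator
          (fun _ => ENNReal.ofReal (a * 2 ^ (k + 1))) ω ∂P := by
        refine lintegral_mono fun ω => ?_
        by_cases hω : a < X ω
        swap
        · simp [hω]
        rw [Set.indicator_of_mem (s := {ω | a < X ω}) hω]
        obtain ⟨k, hk, hk'⟩ := exists_nat_pow_near (x := X ω / a) (y := (2 : ℝ))
          ((one_le_div ha).2 hω.le) one_lt_two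
        rw [le_div_iff₀ ha] at hk
        rw [div_lt_iff₀ ha] at hk'
        rcases hk.lt_or_eq with hlt | heq
        · refine le_trans ?_ (ENNReal.le_tsum k)
          rw [Set.indicator_of_mem (by simpa [mul_comm] using hlt)]
          exact ENNReal.ofReal_le_ofReal (by linarith)
        · rcases k with _ | k
          · simp at heq; linarith
          · refine le_trans ?_ (ENNReal.le_tsum k)
            have hlt : a * 2 ^ k < X ω := by
              rw [← heq, pow_succ]
              nlinarith [pow_pos (two_pos (α := ℝ)) k]
            rw [Set.indicator_of_mem (s := {ω | a * 2 ^ k < X ω}) hlt]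
            exact ENNReal.ofReal_le_ofReal (by linarith)
    _ = ∑' k : ℕ, ENNReal.ofReal (a * 2 ^ (k + 1)) * P {ω | a * 2 ^ k < X ω} := by
        rw [lintegral_tsum fun k => (measurable_const.indicator (hset k)).aemeasurable]
        simp_rw [lintegral_indicator_const (hset _)]
    _ ≤ ∑' k : ℕ, ENNReal.ofReal (2 * a * b * (2 * q) ^ k) := by
        refine ENNReal.tsum_le_tsum fun k => ?_
        refine (mul_le_mul_right (htail k) _).trans_eq ?_
        rw [← ENNReal.ofReal_mul (by positivity)]
        congr 1
        rw [mul_pow, pow_succ]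
        ring
    _ = ENNReal.ofReal (2 * a * b / (1 - 2 * q)) := by
        rw [← ENNReal.ofReal_tsum_of_nonneg (fun k => by positivity)
          ((summable_geometric_of_lt_one (by positivity) hq2).mul_left _), tsum_mul_left,
          tsum_geometric_of_lt_one (by positivity) hq2, div_eq_mul_inv]

end Dyadic

/-- The full de Haan-LePage series: the coordinatewise supremum of all vectors `r i • v i`. -/
noncomputable def fullMax {Ω : Type*} {d : ℕ} (r : ℕ → Ω → ℝ) (v : ℕ → Ω → Fin d → ℝ) (ω : Ω) :
    Fin d → ℝ :=
  fun j => ⨆ i : ℕ, r i ω * v i ω j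

/-- The properties that almost every realisation of a LePage sequence has. -/
structure IsRegularAt {Ω : Type*} {d : ℕ} (r : ℕ → Ω → ℝ) (v : ℕ → Ω → Fin d → ℝ) (ω : Ω) :
    Prop where
  antitone : Antitone fun i => r i ω
  nonneg : ∀ i, 0 ≤ r i ω
  mem_Icc : ∀ i, v i ω ∈ Set.Icc 0 1

namespace IsRegularAt

variable {Ω : Type*} {d : ℕ} {r : ℕ → Ω → ℝ} {v : ℕ → Ω → Fin d → ℝ} {ω : Ω}

lemma mul_nonneg (h : IsRegularAt r v ω) (i : ℕ) (j : Fin d) : 0 ≤ r i ω * v i ω j :=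
  _root_.mul_nonneg (h.nonneg i) ((h.mem_Icc i).1 j)

lemma mul_le (h : IsRegularAt r v ω) (i : ℕ) (j : Fin d) : r i ω * v i ω j ≤ r i ω :=
  mul_le_of_le_one_right (h.nonneg i) ((h.mem_Icc i).2 j)

lemma bddAbove (h : IsRegularAt r v ω) (j : Fin d) :
    BddAbove (Set.range fun i => r i ω * v i ω j) :=
  ⟨r 0 ω, by rintro _ ⟨i, rfl⟩; exact (h.mul_le i j).trans (h.antitone (Nat.zero_le i))⟩

lemma isLUB_fullMax (h : IsRegularAt r v ω) :
    IsLUB (Set.range fun i => r i ω • v i ω) (fullMax r v ω) := by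
  constructor
  · rintro _ ⟨i, rfl⟩ j
    exact le_ciSup (h.bddAbove j) i
  · intro x hx j
    exact ciSup_le fun i => hx ⟨i, rfl⟩ j

lemma le_partialMax {i n : ℕ} (hi : i < n) (j : Fin d) :
    r i ω * v i ω j ≤ partialMax r v n ω j :=
  le_ciSup (f := fun i : Fin n => r i ω * v i ω j) (Set.finite_range _).bddAbove ⟨i, hi⟩

lemma partialMax_nonneg (h : IsRegularAt r v ω) (n : ℕ) : 0 ≤ partialMax r v n ω :=
  fun j => Real.iSup_nonneg fun i => h.mul_nonneg i j

lemma fullMax_nonneg (h : IsRegularAt r v ω) : 0 ≤ fullMax r v ω :=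
  fun j => Real.iSup_nonneg fun i => h.mul_nonneg i j

lemma partialMax_le_fullMax (h : IsRegularAt r v ω) (n : ℕ) :
    partialMax r v n ω ≤ fullMax r v ω :=
  fun j => Real.iSup_le (fun i => le_ciSup (h.bddAbove j) (i : ℕ)) (h.fullMax_nonneg j)

lemma fullMax_le_max (h : IsRegularAt r v ω) (m : ℕ) (j : Fin d) :
    fullMax r v ω j ≤ max (partialMax r v (m + 1) ω j) (r m ω) := by
  refine ciSup_le fun i => ?_
  rcases Nat.lt_or_ge i (m + 1) with hi | hi
  · exact (le_partialMax hi j).trans (le_max_left _ _)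
  · exact ((h.mul_le i j).trans (h.antitone (by omega))).trans (le_max_right _ _)

/-- If some scaled point exceeds `a` in the `j`-th coordinate, the remainder of the series
only matters when the last radius retained exceeds `a`. -/
lemma fullMax_sub_le (h : IsRegularAt r v ω) (m : ℕ) (j : Fin d) (a : ℝ) :
    ENNReal.ofReal (fullMax r v ω j - partialMax r v (m + 1) ω j) ≤
      {ω | ∀ i, r i ω * v i ω j ≤ a}.indicator (fun _ => ENNReal.ofReal a) ω +
      {ω | a < r m ω}.indicator (fun ω => ENNReal.ofReal (r m ω)) ω := by
  have hmax := h.fullMax_le_max m j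
  have hnn : 0 ≤ partialMax r v (m + 1) ω j := h.partialMax_nonneg _ j
  have hr := h.nonneg m
  rcases lt_or_ge a (r m ω) with hra | hra
  · rw [Set.indicator_of_mem (s := {ω | a < r m ω}) hra]
    refine le_add_left (ENNReal.ofReal_le_ofReal ?_)
    rcases max_choice (partialMax r v (m + 1) ω j) (r m ω) with hc | hc <;> linarith
  · by_cases hno : ∀ i, r i ω * v i ω j ≤ a
    · rw [Set.indicator_of_mem (s := {ω | ∀ i, r i ω * v i ω j ≤ a}) hno]
      refine le_add_right (ENNReal.ofReal_le_ofReal ?_)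
      rcases max_choice (partialMax r v (m + 1) ω j) (r m ω) with hc | hc <;> linarith
    · push Not at hno
      obtain ⟨i, hi⟩ := hno
      have him : i < m + 1 := by
        by_contra hcon
        have := (h.mul_le i j).trans (h.antitone (show m ≤ i by omega))
        linarith
      have := le_partialMax (r := r) (v := v) (ω := ω) him j
      rw [max_eq_left (by linarith)] at hmax
      rw [ENNReal.ofReal_of_nonpos (by linarith)]
      exact zero_le

end IsRegularAt

namespace IsLePageSequence

variable {Ω : Type*} [MeasurableSpace Ω] {P : Measure Ω} {d : ℕ}
  {N : Seminorm ℝ (Fin d → ℝ)} {ν : Measure (Fin d → ℝ)} {α : ℝ} {r : ℕ → Ω → ℝ}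
  {v : ℕ → Ω → Fin d → ℝ}

lemma measurable_mul (h : IsLePageSequence P α ν r v) (i : ℕ) (j : Fin d) :
    Measurable fun ω => r i ω * v i ω j :=
  (h.measurable_r i).mul ((measurable_pi_apply j).comp (h.measurable_v i))

lemma measurable_partialMax (h : IsLePageSequence P α ν r v) (n : ℕ) :
    Measurable (partialMax r v n) :=
  measurable_pi_lambda _ fun j => Measurable.iSup fun i => h.measurable_mul i j

lemma measurable_fullMax (h : IsLePageSequence P α ν r v) : Measurable (fullMax r v) :=
  measurable_pi_lambda _ fun j => Measurable.iSup fun i => h.measurable_mul i j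

lemma measurableSet_forall_le (h : IsLePageSequence P α ν r v) (s : ℝ) (j : Fin d) :
    MeasurableSet {ω | ∀ i, r i ω * v i ω j ≤ s} := by
  have : {ω | ∀ i, r i ω * v i ω j ≤ s} = ⋂ i, {ω | r i ω * v i ω j ≤ s} := by ext; simp
  rw [this]
  exact .iInter fun i => measurableSet_le (h.measurable_mul i j) measurable_const

lemma measure_forall_le (h : IsLePageSequence P α ν r v) (hν : IsAngularMeasure N ν)
    (hα : 0 < α) {s : ℝ} (hs : 0 < s) (j : Fin d) :
    P {ω | ∀ i, r i ω * v i ω j ≤ s} = ENNReal.ofReal (Real.exp (-s ^ (-α))) := by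
  have hΛ := hν.polarIntensity_mul_gt hα hs j
  have := h.poisson.measure_eq_zero (measurableSet_fst_mul_gt s j) (by simp [hΛ])
  rw [hΛ, ENNReal.toReal_ofReal (by positivity)] at this
  rw [← this]
  congr 1
  ext ω
  simp [countingMeasure_eq_zero_iff (measurableSet_fst_mul_gt s j)]

open scoped Nat in
lemma measure_r_gt_le (h : IsLePageSequence P α ν r v) [IsFiniteMeasure ν]
    (hα : 0 < α) {s : ℝ} (hs : 0 < s) (m : ℕ) :
    P {ω | s < r m ω} ≤
      ENNReal.ofReal ((s ^ (-α) * ν.real Set.univ) ^ (m + 1) / (m + 1)!) := by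
  have hB : MeasurableSet {p : ℝ × (Fin d → ℝ) | s < p.1} :=
    measurableSet_lt measurable_const measurable_fst
  have hΛ := polarIntensity_fst_gt (ν := ν) hα hs
  have hle := h.poisson.measure_ge_le hB
    (by rw [hΛ]; exact ENNReal.mul_ne_top ENNReal.ofReal_ne_top (measure_ne_top _ _)) (m + 1)
  rw [hΛ, ENNReal.toReal_mul, ENNReal.toReal_ofReal (by positivity)] at hle
  refine (measure_mono_ae ?_).trans hle
  filter_upwards [h.antitone] with ω hanti hω
  refine le_countingMeasure hB fun i hi => ?_
  exact lt_of_lt_of_le hω (hanti (show i ≤ m by omega))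

variable [IsProbabilityMeasure P]

lemma ae_isRegularAt (h : IsLePageSequence P α ν r v) (hν : IsAngularMeasure N ν)
    (hα : 0 < α) (hN : posSphere N ⊆ Set.Icc 0 1) : ∀ᵐ ω ∂P, IsRegularAt r v ω := by
  have := hν.finite
  have hradial : polarIntensity α ν (Set.Iic 0 ×ˢ Set.univ) = 0 := by
    rw [polarIntensity, Measure.prod_prod, radialMeasure_Iic_zero, zero_mul]
  have hangular : polarIntensity α ν (Set.univ ×ˢ (Set.Icc 0 1)ᶜ) = 0 := by
    rw [polarIntensity, Measure.prod_prod, angularRoot,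
      Measure.map_apply measurable_rootVec measurableSet_Icc.compl]
    have : ν (rootVec α ⁻¹' (Set.Icc 0 1)ᶜ) = 0 := by
      have hroot : ∀ᵐ u ∂ν, rootVec α u ∈ Set.Icc 0 1 := by
        filter_upwards [hν.ae_mem_Icc hN] with u hu
        exact ⟨fun j => Real.rpow_nonneg (hu.1 j) _,
          fun j => Real.rpow_le_one (hu.1 j) (hu.2 j) (by positivity)⟩
      exact hroot
    rw [this, mul_zero]
  have hm₁ : MeasurableSet (Set.Iic (0 : ℝ) ×ˢ (Set.univ : Set (Fin d → ℝ))) :=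
    measurableSet_Iic.prod .univ
  have hm₂ : MeasurableSet ((Set.univ : Set ℝ) ×ˢ (Set.Icc (0 : Fin d → ℝ) 1)ᶜ) :=
    MeasurableSet.univ.prod measurableSet_Icc.compl
  filter_upwards [h.antitone, h.poisson.ae_eq_zero hm₁ hradial,
    h.poisson.ae_eq_zero hm₂ hangular] with ω hanti h₁ h₂
  rw [countingMeasure_eq_zero_iff hm₁] at h₁
  rw [countingMeasure_eq_zero_iff hm₂] at h₂
  refine ⟨hanti, fun i => ?_, fun i => ?_⟩
  · have := h₁ i
    simp only [Set.mem_prod, Set.mem_Iic, Set.mem_univ, and_true, not_le] at this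
    exact this.le
  · have := h₂ i
    simpa only [Set.mem_prod, Set.mem_univ, true_and, Set.mem_compl_iff, not_not] using this

/-- The law of the full series is the max-stable law. -/
lemma map_fullMax_eq (h : IsLePageSequence P α ν r v) (hν : IsAngularMeasure N ν)
    (hα : 0 < α) (hN : posSphere N ⊆ Set.Icc 0 1) {Q : Measure (Fin d → ℝ)}
    (hQ : IsMaxStableLaw α ν Q) : P.map (fullMax r v) = Q := by
  obtain ⟨Ω', _, P', y, Y, _, -, hY, hpois, hlub, rfl⟩ := hQ
  have := hν.finite
  have hmap := h.poisson.map (f := fun p => p.1 • p.2) (by fun_prop)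
  rw [map_smul_polarIntensity, ← countingMeasure_comp (by fun_prop)] at hmap
  exact map_eq_of_isLUB h.measurable_fullMax hY hmap hpois
    ((h.ae_isRegularAt hν hα hN).mono fun ω hω => hω.isLUB_fullMax) hlub

lemma measure_fullMax_gt_le (h : IsLePageSequence P α ν r v) (hν : IsAngularMeasure N ν)
    (hα : 0 < α) {s : ℝ} (hs : 0 < s) (j : Fin d) :
    P {ω | s < fullMax r v ω j} ≤ ENNReal.ofReal (s ^ (-α)) := by
  have hsub : {ω | s < fullMax r v ω j} ⊆ {ω | ∀ i, r i ω * v i ω j ≤ s}ᶜ := by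
    intro ω hω hle
    exact (lt_irrefl s) (lt_of_lt_of_le hω (ciSup_le hle))
  have hmeas := h.measurableSet_forall_le s j
  refine (measure_mono hsub).trans ?_
  rw [prob_compl_eq_one_sub hmeas, h.measure_forall_le hν hα hs j, ← ENNReal.ofReal_one,
    ← ENNReal.ofReal_sub _ (by positivity)]
  refine ENNReal.ofReal_le_ofReal ?_
  linarith [Real.add_one_le_exp (-s ^ (-α))]

lemma lintegral_fullMax_lt_top (h : IsLePageSequence P α ν r v) (hν : IsAngularMeasure N ν)
    (hα : 1 < α) (j : Fin d) : ∫⁻ ω, ENNReal.ofReal (fullMax r v ω j) ∂P < ∞ := by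
  have hX : Measurable fun ω => fullMax r v ω j :=
    (measurable_pi_apply j).comp h.measurable_fullMax
  have hq : 2 * (2 : ℝ) ^ (-α) < 1 := by
    calc 2 * (2 : ℝ) ^ (-α) < 2 * (2 : ℝ) ^ (-1 : ℝ) := by
          gcongr 2 * ?_
          exact Real.rpow_lt_rpow_of_exponent_lt one_lt_two (neg_lt_neg hα)
      _ = 1 := by rw [Real.rpow_neg_one]; norm_num
  have htail := lintegral_indicator_gt_le (P := P) hX one_pos zero_le_one
    (Real.rpow_nonneg zero_le_two (-α)) hq fun k => by
      refine (h.measure_fullMax_gt_le hν (by linarith) (by positivity) j).trans_eq ?_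
      rw [one_mul, one_mul, ← Real.rpow_natCast 2 k, ← Real.rpow_natCast, ← Real.rpow_mul (by simp),
        ← Real.rpow_mul (by simp), mul_comm]
  calc ∫⁻ ω, ENNReal.ofReal (fullMax r v ω j) ∂P
      ≤ ∫⁻ ω, (1 + {ω | 1 < fullMax r v ω j}.indicator
          (fun ω => ENNReal.ofReal (fullMax r v ω j)) ω) ∂P := by
        refine lintegral_mono fun ω => ?_
        rcases lt_or_ge 1 (fullMax r v ω j) with hω | hω
        · simp only [Set.indicator_of_mem (s := {ω | 1 < fullMax r v ω j}) hω]
          exact le_add_self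
        · exact le_add_right (by simpa using hω)
    _ = 1 + ∫⁻ ω, {ω | 1 < fullMax r v ω j}.indicator
          (fun ω => ENNReal.ofReal (fullMax r v ω j)) ω ∂P := by
        rw [lintegral_add_left measurable_const]; simp
    _ < ∞ := ENNReal.add_lt_top.2 ⟨ENNReal.one_lt_top, htail.trans_lt ENNReal.ofReal_lt_top⟩

/-- The expected error made in one coordinate by truncating the series. -/
lemma lintegral_fullMax_sub_le (h : IsLePageSequence P α ν r v) (hν : IsAngularMeasure N ν)
    (hα : 1 < α) (hN : posSphere N ⊆ Set.Icc 0 1) {K : ℝ} (hK : 1 ≤ K)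
    (hνK : ν.real Set.univ ≤ K) {n : ℕ} (hn : 2 ≤ n) (j : Fin d) :
    ∫⁻ ω, ENNReal.ofReal (fullMax r v ω j - partialMax r v n ω j) ∂P ≤
      ENNReal.ofReal (5 * (K * Real.exp 2) ^ 2 * (n : ℝ) ^ (-(1 + 1 / α))) := by
  have := hν.finite
  have hα0 : 0 < α := by linarith
  obtain ⟨m, rfl⟩ : ∃ m, n = m + 1 := ⟨n - 1, by omega⟩
  set n := m + 1 with hn_def
  have hn0 : (0 : ℝ) < n := by positivity
  set D := K * Real.exp 2 with hD
  have hD1 : 1 ≤ D := one_le_mul_of_one_le_of_one_le hK (Real.one_le_exp zero_le_two)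
  have hD0 : 0 < D := by linarith
  set a : ℝ := (n / D) ^ (-(1 / α)) with ha_def
  have ha : 0 < a := by positivity
  have haα : a ^ (-α) = n / D := by
    rw [ha_def, ← Real.rpow_mul (by positivity)]
    rw [show -(1 / α) * -α = 1 by field_simp, Real.rpow_one]
  set q : ℝ := ((2 : ℝ) ^ (-α)) ^ n with hq_def
  have hq0 : 0 ≤ q := by positivity
  have hq4 : q ≤ 1 / 4 := by
    have h2 : (2 : ℝ) ^ (-α) ≤ 1 / 2 := by
      calc (2 : ℝ) ^ (-α) ≤ (2 : ℝ) ^ (-1 : ℝ) :=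
            Real.rpow_le_rpow_of_exponent_le one_le_two (neg_le_neg hα.le)
        _ = 1 / 2 := by rw [Real.rpow_neg_one]; norm_num
    calc q ≤ (1 / 2) ^ n := pow_le_pow_left₀ (by positivity) h2 n
      _ ≤ (1 / 2) ^ 2 := pow_le_pow_of_le_one (by norm_num) (by norm_num) hn
      _ = 1 / 4 := by norm_num
  have htail (k : ℕ) :
      P {ω | a * 2 ^ k < r m ω} ≤ ENNReal.ofReal (Real.exp (-n) * q ^ k) := by
    refine (h.measure_r_gt_le hα0 (by positivity) m).trans (ENNReal.ofReal_le_ofReal ?_)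
    have hpow : (a * 2 ^ k) ^ (-α) = n / D * ((2 : ℝ) ^ (-α)) ^ k := by
      rw [Real.mul_rpow ha.le (by positivity), haα, ← Real.rpow_natCast 2 k,
        ← Real.rpow_natCast, ← Real.rpow_mul (by simp), ← Real.rpow_mul (by simp), mul_comm (-α)]
    rw [hpow, ← hn_def]
    calc (n / D * ((2 : ℝ) ^ (-α)) ^ k * ν.real Set.univ) ^ n / n.factorial
        ≤ (n / D * ((2 : ℝ) ^ (-α)) ^ k * K) ^ n / n.factorial := by gcongr
      _ = (n : ℝ) ^ n / n.factorial * (Real.exp (-2)) ^ n * q ^ k := by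
          have : n / D * ((2 : ℝ) ^ (-α)) ^ k * K = n * Real.exp (-2) * ((2 : ℝ) ^ (-α)) ^ k := by
            rw [hD, Real.exp_neg]
            have := (Real.exp_pos 2).ne'
            field_simp
          rw [this, mul_pow, mul_pow, hq_def, ← pow_mul, ← pow_mul, mul_comm k n]
          ring
      _ ≤ Real.exp n * (Real.exp (-2)) ^ n * q ^ k := by
          gcongr
          exact Real.pow_div_factorial_le_exp n (by positivity) n
      _ = Real.exp (-n) * q ^ k := by
          rw [← Real.exp_nat_mul, ← Real.exp_add]
          congr 2
          ring
  have hradial := lintegral_indicator_gt_le (P := P) (h.measurable_r m) ha (Real.exp_pos _).le hq0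
    (by linarith) htail
  have hmeas := h.measurableSet_forall_le a j
  calc ∫⁻ ω, ENNReal.ofReal (fullMax r v ω j - partialMax r v n ω j) ∂P
      ≤ ∫⁻ ω, ({ω | ∀ i, r i ω * v i ω j ≤ a}.indicator (fun _ => ENNReal.ofReal a) ω +
          {ω | a < r m ω}.indicator (fun ω => ENNReal.ofReal (r m ω)) ω) ∂P := by
        refine lintegral_mono_ae ?_
        filter_upwards [h.ae_isRegularAt hν hα0 hN] with ω hω
        exact hω.fullMax_sub_le m j a
    _ ≤ ENNReal.ofReal a * ENNReal.ofReal (Real.exp (-(n / D))) +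
          ENNReal.ofReal (2 * a * Real.exp (-n) / (1 - 2 * q)) := by
        rw [lintegral_add_left (measurable_const.indicator hmeas),
          lintegral_indicator_const hmeas, h.measure_forall_le hν hα0 ha j, haα]
        gcongr
    _ = ENNReal.ofReal (a * Real.exp (-(n / D)) + 2 * a * Real.exp (-n) / (1 - 2 * q)) := by
        rw [← ENNReal.ofReal_mul ha.le, ← ENNReal.ofReal_add (by positivity)]
        exact div_nonneg (by positivity) (by linarith)
    _ ≤ _ := by
        refine ENNReal.ofReal_le_ofReal ?_
        have hexp : Real.exp (-(n / D)) ≤ D / n := by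
          rw [Real.exp_neg, ← inv_div (n : ℝ) D]
          refine inv_anti₀ (by positivity) ?_
          linarith [Real.add_one_le_exp (n / D : ℝ)]
        have hexp' : Real.exp (-n) ≤ D / n := by
          refine le_trans (Real.exp_le_exp.2 (neg_le_neg ?_)) hexp
          exact div_le_self hn0.le hD1
        have hden : 2 * a * Real.exp (-n) / (1 - 2 * q) ≤ 4 * a * Real.exp (-n) := by
          rw [div_le_iff₀ (by linarith)]
          have : 0 < a * Real.exp (-n) := by positivity
          nlinarith
        have haD : a ≤ D * (n : ℝ) ^ (-(1 / α)) := by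
          rw [ha_def, Real.div_rpow hn0.le hD0.le, div_eq_mul_inv, ← Real.rpow_neg hD0.le, neg_neg,
            mul_comm]
          gcongr
          calc D ^ (1 / α) ≤ D ^ (1 : ℝ) :=
                Real.rpow_le_rpow_of_exponent_le hD1 ((div_le_one hα0).2 hα.le)
            _ = D := Real.rpow_one D
        calc a * Real.exp (-(n / D)) + 2 * a * Real.exp (-n) / (1 - 2 * q)
            ≤ a * (D / n) + 4 * a * (D / n) := by
              refine add_le_add (by gcongr) (hden.trans (by gcongr))
          _ = 5 * a * (D / n) := by ring
          _ ≤ 5 * (D * (n : ℝ) ^ (-(1 / α))) * (D / n) := by gcongr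
          _ = 5 * D ^ 2 * (n : ℝ) ^ (-(1 + 1 / α)) := by
              rw [neg_add, Real.rpow_add hn0, Real.rpow_neg_one]
              field_simp

end IsLePageSequence

section Lipschitz

variable {d : ℕ} {f : (Fin d → ℝ) → ℝ} {Q : Measure (Fin d → ℝ)}

lemma IsLipOne.continuousOn (hf : IsLipOne f) : ContinuousOn f (Set.Ici 0) := by
  have hlip : LipschitzOnWith (d : ℝ≥0) f (Set.Ici 0) := by
    refine LipschitzOnWith.of_dist_le_mul fun x hx y hy => ?_
    calc dist (f x) (f y) ≤ ∑ j, |x j - y j| := hf x y hx hy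
      _ ≤ ∑ _j : Fin d, dist x y := Finset.sum_le_sum fun j _ => dist_le_pi_dist x y j
      _ = ((d : ℝ≥0) : ℝ) * dist x y := by simp
  exact hlip.continuousOn

lemma IsLipOne.integrable (hf : IsLipOne f) [IsFiniteMeasure Q] (hpos : ∀ᵐ x ∂Q, 0 ≤ x)
    (hint : ∀ j, Integrable (fun x => x j) Q) : Integrable f Q := by
  have hmeas : AEStronglyMeasurable f Q := by
    rw [← Measure.restrict_eq_self_of_ae_mem (s := Set.Ici 0) hpos]
    exact hf.continuousOn.aestronglyMeasurable measurableSet_Ici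
  refine Integrable.mono' ((integrable_const |f 0|).add
    (integrable_finsetSum Finset.univ fun j _ => (hint j).abs)) hmeas ?_
  filter_upwards [hpos] with x hx
  have := hf x 0 hx le_rfl
  simp only [Pi.zero_apply, sub_zero] at this
  simp only [Real.norm_eq_abs, Pi.add_apply]
  linarith [abs_sub_abs_le_abs_sub (f x) (f 0)]

lemma IsLipOne.abs_integral_sub_le {Ω : Type*} [MeasurableSpace Ω] {P : Measure Ω}
    (hf : IsLipOne f) {X Y : Ω → Fin d → ℝ} (hX : Measurable X) (hY : Measurable Y)
    (hX0 : ∀ᵐ ω ∂P, 0 ≤ X ω) (hY0 : ∀ᵐ ω ∂P, 0 ≤ Y ω)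
    (hXi : ∀ j, Integrable (fun ω => X ω j) P) (hYi : ∀ j, Integrable (fun ω => Y ω j) P)
    (hfX : Integrable f (P.map X)) (hfY : Integrable f (P.map Y)) :
    |∫ x, f x ∂(P.map X) - ∫ x, f x ∂(P.map Y)| ≤ ∑ j, ∫ ω, |X ω j - Y ω j| ∂P := by
  have hfX' : Integrable (fun ω => f (X ω)) P := hfX.comp_measurable hX
  have hfY' : Integrable (fun ω => f (Y ω)) P := hfY.comp_measurable hY
  have hXY (j : Fin d) : Integrable (fun ω => |X ω j - Y ω j|) P := ((hXi j).sub (hYi j)).abs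
  rw [integral_map hX.aemeasurable hfX.1, integral_map hY.aemeasurable hfY.1,
    ← integral_sub hfX' hfY', ← integral_finsetSum _ fun j _ => hXY j]
  refine (abs_integral_le_integral_abs).trans (integral_mono_ae (hfX'.sub hfY').abs
    (integrable_finsetSum _ fun j _ => hXY j) ?_)
  filter_upwards [hX0, hY0] with ω h₁ h₂
  exact hf _ _ h₁ h₂

end Lipschitz

namespace IsLePageSequence

variable {Ω : Type*} [MeasurableSpace Ω] {P : Measure Ω} [IsProbabilityMeasure P] {d : ℕ}
  {N : Seminorm ℝ (Fin d → ℝ)} {ν : Measure (Fin d → ℝ)} {α : ℝ} {r : ℕ → Ω → ℝ}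
  {v : ℕ → Ω → Fin d → ℝ}

lemma integrable_fullMax (h : IsLePageSequence P α ν r v) (hν : IsAngularMeasure N ν)
    (hα : 1 < α) (hN : posSphere N ⊆ Set.Icc 0 1) (j : Fin d) :
    Integrable (fun ω => fullMax r v ω j) P := by
  refine ⟨((measurable_pi_apply j).comp h.measurable_fullMax).aestronglyMeasurable, ?_⟩
  rw [hasFiniteIntegral_iff_ofReal]
  · exact h.lintegral_fullMax_lt_top hν hα j
  · filter_upwards [h.ae_isRegularAt hν (by linarith) hN] with ω hω
    exact hω.fullMax_nonneg j

lemma integrable_partialMax (h : IsLePageSequence P α ν r v) (hν : IsAngularMeasure N ν)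
    (hα : 1 < α) (hN : posSphere N ⊆ Set.Icc 0 1) (n : ℕ) (j : Fin d) :
    Integrable (fun ω => partialMax r v n ω j) P := by
  refine (h.integrable_fullMax hν hα hN j).mono'
    ((measurable_pi_apply j).comp (h.measurable_partialMax n)).aestronglyMeasurable ?_
  filter_upwards [h.ae_isRegularAt hν (by linarith) hN] with ω hω
  rw [Real.norm_of_nonneg (hω.partialMax_nonneg n j)]
  exact hω.partialMax_le_fullMax n j

lemma integral_abs_sub_le (h : IsLePageSequence P α ν r v) (hν : IsAngularMeasure N ν)
    (hα : 1 < α) (hN : posSphere N ⊆ Set.Icc 0 1) {K : ℝ} (hK : 1 ≤ K)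
    (hνK : ν.real Set.univ ≤ K) {n : ℕ} (hn : 2 ≤ n) (j : Fin d) :
    ∫ ω, |partialMax r v n ω j - fullMax r v ω j| ∂P ≤
      5 * (K * Real.exp 2) ^ 2 * (n : ℝ) ^ (-(1 + 1 / α)) := by
  have hreg := h.ae_isRegularAt hν (by linarith) hN
  have habs : ∀ᵐ ω ∂P, |partialMax r v n ω j - fullMax r v ω j| =
      fullMax r v ω j - partialMax r v n ω j := by
    filter_upwards [hreg] with ω hω
    rw [abs_sub_comm, abs_of_nonneg (sub_nonneg.2 (hω.partialMax_le_fullMax n j))]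
  rw [integral_congr_ae habs, ← ENNReal.ofReal_le_ofReal_iff (by positivity),
    ofReal_integral_eq_lintegral_ofReal (f := fun ω => fullMax r v ω j - partialMax r v n ω j)
      ((h.integrable_fullMax hν hα hN j).sub (h.integrable_partialMax hν hα hN n j))
      (hreg.mono fun ω hω => sub_nonneg.2 (hω.partialMax_le_fullMax n j))]
  exact h.lintegral_fullMax_sub_le hν hα hN hK hνK hn j

end IsLePageSequence

end MaxStable

theorem mainTheorem2 {d : ℕ} (N : Seminorm ℝ (Fin d → ℝ)) (hN : ∀ x, N x = 0 → x = 0)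
    (hN_normalized : MaxStable.posSphere N ⊆ Set.Icc 0 1) :
    ∃ C : ℝ → ℝ,
      (∀ α : ℝ, 1 < α → 0 < C α) ∧
      (C =O[𝓝[>] 1] fun α : ℝ => ((1 - 1 / α) ^ 2)⁻¹) ∧
      ∀ α : ℝ, 1 < α →
      ∀ ν : Measure (Fin d → ℝ), MaxStable.IsAngularMeasure N ν →
      ∀ (Ω : Type*) [MeasurableSpace Ω] (P : Measure Ω) [IsProbabilityMeasure P]
        (r : ℕ → Ω → ℝ) (v : ℕ → Ω → Fin d → ℝ), MaxStable.IsLePageSequence P α ν r v →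
      ∀ (Ω' : Type*) [MeasurableSpace Ω'] (P' : Measure Ω') [IsProbabilityMeasure P']
        (Z : Ω' → Fin d → ℝ), Measurable Z → MaxStable.IsMaxStableLaw α ν (P'.map Z) →
      ∀ n : ℕ, 2 ≤ n →
        (∀ h : (Fin d → ℝ) → ℝ, MaxStable.IsLipTwo h →
          Integrable h (P.map (MaxStable.partialMax r v n)) ∧ Integrable h (P'.map Z)) ∧
        MaxStable.dTwo (P.map (MaxStable.partialMax r v n)) (P'.map Z) ≤
          ENNReal.ofReal (C α * (n : ℝ) ^ (-(1 + 1 / α))) := by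
  have hsum : 0 ≤ ∑ j, N (Pi.single j 1) := Finset.sum_nonneg fun j _ => apply_nonneg N _
  set K : ℝ := 1 + ∑ j, N (Pi.single j 1) with hK_def
  have hK : 1 ≤ K := by linarith
  set c : ℝ := 5 * (K * Real.exp 2) ^ 2
  refine ⟨fun _ => d * c + 1, fun α _ => by positivity, ?_, ?_⟩
  · refine IsBigO.of_bound (d * c + 1) ?_
    filter_upwards [self_mem_nhdsWithin] with α hα
    have hα : 1 < α := hα
    have hlt : 0 < 1 - 1 / α := sub_pos.2 ((div_lt_one (by linarith)).2 hα)
    have hle : 1 - 1 / α ≤ 1 := by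
      have : 0 < 1 / α := by positivity
      linarith
    rw [Real.norm_of_nonneg (by positivity), Real.norm_of_nonneg (by positivity)]
    exact le_mul_of_one_le_right (by positivity)
      ((one_le_inv₀ (by positivity)).2 (pow_le_one₀ hlt.le hle))
  intro α hα ν hν Ω _ P _ r v h Ω' _ P' _ Z _ hZ n hn
  rw [← h.map_fullMax_eq hν (by linarith) hN_normalized hZ]
  have hreg := h.ae_isRegularAt hν (by linarith) hN_normalized
  have hmX := h.measurable_partialMax n
  have hmY := h.measurable_fullMax
  have hX0 : ∀ᵐ ω ∂P, 0 ≤ MaxStable.partialMax r v n ω :=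
    hreg.mono fun ω hω => hω.partialMax_nonneg n
  have hY0 : ∀ᵐ ω ∂P, 0 ≤ MaxStable.fullMax r v ω := hreg.mono fun ω hω => hω.fullMax_nonneg
  have hXi := h.integrable_partialMax hν hα hN_normalized n
  have hYi := h.integrable_fullMax hν hα hN_normalized
  have hint {X : Ω → Fin d → ℝ} (hm : Measurable X) (h0 : ∀ᵐ ω ∂P, 0 ≤ X ω)
      (hi : ∀ j, Integrable (fun ω => X ω j) P) {f : (Fin d → ℝ) → ℝ}
      (hf : MaxStable.IsLipTwo f) : Integrable f (P.map X) :=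
    hf.lip.integrable ((ae_map_iff hm.aemeasurable measurableSet_Ici).2 h0) fun j =>
      (integrable_map_measure (measurable_pi_apply j).aestronglyMeasurable hm.aemeasurable).2 (hi j)
  refine ⟨fun f hf => ⟨hint hmX hX0 hXi hf, hint hmY hY0 hYi hf⟩, ?_⟩
  refine iSup₂_le fun f hf => ENNReal.ofReal_le_ofReal ?_
  calc _ ≤ ∑ j, ∫ ω, |MaxStable.partialMax r v n ω j - MaxStable.fullMax r v ω j| ∂P :=
        hf.lip.abs_integral_sub_le hmX hmY hX0 hY0 hXi hYi (hint hmX hX0 hXi hf)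
          (hint hmY hY0 hYi hf)
    _ ≤ ∑ _j : Fin d, c * (n : ℝ) ^ (-(1 + 1 / α)) := Finset.sum_le_sum fun j _ =>
        h.integral_abs_sub_le hν hα hN_normalized hK (by linarith [hν.measureReal_univ_le]) hn j
    _ = d * c * (n : ℝ) ^ (-(1 + 1 / α)) := by simp [mul_assoc]
    _ ≤ (d * c + 1) * (n : ℝ) ^ (-(1 + 1 / α)) := by gcongr; linarith
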